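/- Let $G=(V,E)$ be a finite directed acyclic graph with $n=|V|$ nodes. A node $j$ with an edge to $i$ is an in-neighbour of $i$, and $\mathcal N_i$ is the set of in-neighbours of $i$; a source is a node without incoming edges and a sink is a node without outgoing edges. Each edge from $j$ to $i$ carries a function $f_{i,j}:\mathbb R\to\mathbb R$ and a known delay $m_{i,j}\in\{1,2,\dots\}$. Let $\mathcal N^e,\mathcal N^m\subseteq V$ be the sets of excited and of measured nodes, and $N^{m,e}=|\mathcal N^e|+|\mathcal N^m|$. The outputs are determined by $$y_i^k=\sum_{j\in\mathcal N_i}f_{i,j}\bigl(y_j^{k-m_{i,j}}\bigr)+u_i^{k-1},\qquad i\in V,\ k\in\mathbb Z,$$ where the excitation signals $u_i$ are arbitrary for $i\in\mathcal N^e$ and zero for $i\notin\mathcal N^e$. Hence $y_i^k=u_i^{k-1}+F_i$, where $F_i$ is a function of the past excitation signals of the excited nodes. Let $\mathcal F_{Z,NL}$ be the class of functions $f:\mathbb R\to\mathbb R$ that are real-analytic on $\mathbb R$, satisfy $f(0)=0$, have range $\mathbb R$, and whose Taylor series $\sum_{n\ge1}a_nx^n$ at $0$ has some $a_n\ne0$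 with $n>1$. The network with edge functions $\{f_{i,j}\}$ in $\mathcal F_{Z,NL}$ is identifiable in $\mathcal F_{Z,NL}$ if, for every family $\{\tilde f_{i,j}\}$ of edge functions in $\mathcal F_{Z,NL}$ on the same graph with the same delays, $F_i=\tilde F_i$ for all $i\in\mathcal N^m$ implies $f_{i,j}=\tilde f_{i,j}$ for every edge. For $v\in\mathbb R^{\mathcal N^e}$ let $J_G(v)$ be the $V\times V$ matrix whose $(i,j)$ entry is $f_{i,j}'(y_j)$ if there is an edge from $j$ to $i$ and $0$ otherwise, where in $y_j$ all excitation signals of an excited node $e$, at every delay, are replaced by $v_e$. Call $J_G$ generic if there is a point $v^*$ such that, for all $A,B\subseteq V$, the submatrix with rows $A$ and columns $B$ of $(I-J_G(v^*))^{-1}$ has the largest rank among the corresponding submatrices of $(I-M)^{-1}$, where $M$ ranges over all real matrices with $M_{i,j}=0$ whenever there is no edge from $j$ to $i$. **Theorem.** Suppose that all edge functions lie in $\mathcal F_{Z,NL}$, that $J_G$ is generic, and that 1. all sources are excited, all sinks are measured, and every other node is excited or measured; 2. for each node $i$ there are mutually vertex-disjoint directed paths, one for each in-neighbour of $i$, each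 starting at an excited node and ending at that in-neighbour (a path may consist of a single vertex). Then the network is identifiable in $\mathcal F_{Z,NL}$. Moreover $N^{m,e}=n$ if and only if no node is both excited and measured; in particular, under the two conditions, a pattern in which no node is both excited and measured identifies the network with $N^{m,e}=n$. -/

import Mathlib

/-- The class of pure nonlinear functions `f : ℝ → ℝ`: real-analytic on `ℝ`, vanishing at `0`, with
at least one nonzero Taylor coefficient `a_n = f⁽ⁿ⁾(0) / n!` of order `n > 1`, and with range `ℝ`. -/
def classFZNL : Set (ℝ → ℝ) :=
  {f | AnalyticOnNhd ℝ f Set.univ ∧ f 0 = 0 ∧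
    (∃ n : ℕ, 1 < n ∧ iteratedDeriv n f 0 / (n.factorial : ℝ) ≠ 0) ∧
    Set.range f = Set.univ}

/-- A directed acyclic graph with a positive delay on every edge. `graph.Adj j i` is the edge from
`j` to `i`, which carries the function `f i j` and the delay `delay i j`
(values of `delay` off the edges play no role). -/
structure DAGNetwork (V : Type*) where
  graph : Digraph V
  acyclic : ∀ i, ¬ Relation.TransGen graph.Adj i i
  delay : V → V → ℕ+

namespace DAGNetwork

variable {V : Type*}

/-- A source has no incoming edge. -/
def IsSource (N : DAGNetwork V) (i : V) : Prop := ∀ j, ¬ N.graph.Adj j i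

/-- A sink has no outgoing edge. -/
def IsSink (N : DAGNetwork V) (i : V) : Prop := ∀ j, ¬ N.graph.Adj i j

theorem wellFounded_adj [Finite V] (N : DAGNetwork V) : WellFounded N.graph.Adj := by
  have : Std.Irrefl (Relation.TransGen N.graph.Adj) := ⟨N.acyclic⟩
  have h : WellFounded (Relation.TransGen N.graph.Adj) :=
    Finite.wellFounded_of_trans_of_irrefl _
  exact Subrelation.wf (fun h => Relation.TransGen.single h) h

open Classical in
/-- The set of in-neighbours of `i`. -/
noncomputable def inNbrs [Fintype V] (N : DAGNetwork V) (i : V) : Finset V :=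
  Finset.univ.filter fun j => N.graph.Adj j i

open Classical in
/-- The output `y_i^k` of node `i` at time `k`, for the edge functions `f` and the inputs `u`;
`output_eq` and `eq_output` say that it is the unique solution of the model equation. -/
noncomputable def output [Fintype V] (N : DAGNetwork V) (f : V → V → ℝ → ℝ) (u : V → ℤ → ℝ) :
    V → ℤ → ℝ :=
  N.wellFounded_adj.fix fun i y k =>
    (∑ j, if h : N.graph.Adj j i then f i j (y j h (k - (N.delay i j : ℕ))) else 0) + u i (k - 1)

/-- The model equation `y_i^k = ∑_{j ∈ 𝒩_i} f_{i,j}(y_j^{k - m_{i,j}}) + u_i^{k-1}`. -/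
theorem output_eq [Fintype V] (N : DAGNetwork V) (f : V → V → ℝ → ℝ) (u : V → ℤ → ℝ)
    (i : V) (k : ℤ) :
    N.output f u i k =
      (∑ j ∈ N.inNbrs i, f i j (N.output f u j (k - (N.delay i j : ℕ)))) + u i (k - 1) := by
  classical
  rw [output, WellFounded.fix_eq, inNbrs, Finset.sum_filter]
  rfl

theorem eq_output [Fintype V] (N : DAGNetwork V) (f : V → V → ℝ → ℝ) (u y : V → ℤ → ℝ)
    (hy : ∀ i k, y i k =
      (∑ j ∈ N.inNbrs i, f i j (y j (k - (N.delay i j : ℕ)))) + u i (k - 1)) :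
    y = N.output f u := by
  classical
  funext i
  induction i using N.wellFounded_adj.induction with
  | _ i ih =>
    funext k
    rw [hy, output_eq]
    congr 1
    refine Finset.sum_congr rfl fun j hj => ?_
    rw [ih j (by simpa [inNbrs] using hj)]

/-- Excitation signals on the excited nodes `Ne`, extended by zero to the other nodes. -/
def extendInput [DecidableEq V] (Ne : Finset V) (u : Ne → ℤ → ℝ) : V → ℤ → ℝ :=
  fun i k => if h : i ∈ Ne then u ⟨i, h⟩ k else 0

/-- The function `F_i`, which expresses the output of node `i` through the past excitation signals
of the excited nodes: `y_i^k = u_i^{k-1} + F_i(…)`. -/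
noncomputable def nodeFun [Fintype V] [DecidableEq V] (N : DAGNetwork V) (Ne : Finset V)
    (f : V → V → ℝ → ℝ) (i : V) : (Ne → ℤ → ℝ) → ℤ → ℝ :=
  fun u k => N.output f (extendInput Ne u) i k - extendInput Ne u i (k - 1)

/-- The edge functions all belong to the class `𝓕`. -/
def EdgesIn (N : DAGNetwork V) (𝓕 : Set (ℝ → ℝ)) (f : V → V → ℝ → ℝ) : Prop :=
  ∀ i j, N.graph.Adj j i → f i j ∈ 𝓕

/-- The network with edge functions `f` is identifiable in the class `𝓕` with excited nodes `Ne` and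
measured nodes `Nm`: edge functions in `𝓕` that generate the same measured functions as `f` are
equal to `f` on every edge. -/
def IsIdentifiable [Fintype V] [DecidableEq V] (N : DAGNetwork V) (𝓕 : Set (ℝ → ℝ))
    (Ne Nm : Finset V) (f : V → V → ℝ → ℝ) : Prop :=
  ∀ f' : V → V → ℝ → ℝ, N.EdgesIn 𝓕 f' →
    (∀ i ∈ Nm, N.nodeFun Ne f i = N.nodeFun Ne f' i) →
    ∀ i j, N.graph.Adj j i → f i j = f' i j

/-- The number of identification actions `N^{m,e} = |𝒩^e| + |𝒩^m|`. -/
def numActions (Ne Nm : Finset V) : ℕ := Ne.card + Nm.card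

open Classical in
/-- The nonlinear network matrix `J_G(v)`: its entry `(i, j)` is `f_{i,j}'(y_j)` if there is an edge
from `j` to `i` and `0` otherwise, where in `y_j` the excitation signals of an excited node `e`,
at every delay, are replaced by the same number `v e`. -/
noncomputable def netMatrix [Fintype V] [DecidableEq V] (N : DAGNetwork V) (Ne : Finset V)
    (f : V → V → ℝ → ℝ) (v : Ne → ℝ) : Matrix V V ℝ :=
  fun i j =>
    if N.graph.Adj j i then deriv (f i j) (N.output f (extendInput Ne fun e _ => v e) j 0) else 0

/-- The submatrix `T^{A,B}` of `T = (I - M)⁻¹` with rows `A` and columns `B`. -/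
noncomputable def subT [Fintype V] [DecidableEq V] (M : Matrix V V ℝ) (A B : Finset V) :
    Matrix A B ℝ :=
  ((1 - M)⁻¹).submatrix (fun a : A => (a : V)) (fun b : B => (b : V))

/-- The nonlinear network matrix is generic: at some point `v`, every submatrix `T^{A,B}` of
`T = (I - J_G(v))⁻¹` attains the maximal rank that it can have when the entries of `J_G` on the
edges are replaced by free real variables. -/
def IsGeneric [Fintype V] [DecidableEq V] (N : DAGNetwork V) (Ne : Finset V)
    (f : V → V → ℝ → ℝ) : Prop :=
  ∃ v : Ne → ℝ, ∀ A B : Finset V, ∀ M : Matrix V V ℝ,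
    (∀ i j, ¬ N.graph.Adj j i → M i j = 0) →
    (subT M A B).rank ≤ (subT (N.netMatrix Ne f v) A B).rank

/-- `p` is the vertex list of a directed path from `a` to `b`; a single vertex is a path. -/
def IsPath (N : DAGNetwork V) (a b : V) (p : List V) : Prop :=
  p.IsChain N.graph.Adj ∧ p.Nodup ∧ p.head? = some a ∧ p.getLast? = some b

/-- There are mutually vertex-disjoint paths, one for each node of `B`, from nodes of `A` to the
nodes of `B`. -/
def HasDisjointPaths (N : DAGNetwork V) (A B : Finset V) : Prop :=
  ∃ (s : V → V) (p : V → List V),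
    (∀ j ∈ B, s j ∈ A ∧ N.IsPath (s j) j (p j)) ∧
    (∀ j ∈ B, ∀ j' ∈ B, j ≠ j' → (p j).Disjoint (p j'))

end DAGNetwork

/-!
# Identifiability of nonlinear networks from partial excitation and partial measurement

Feed the network with inputs that are constant in time. The outputs are then constant as well, and
the two networks under comparison become static systems `y_i = ∑ f_{i,j}(y_j) + w_i` and
`y'_i = ∑ f'_{i,j}(y'_j) + w_i`, with `y_i = y'_i` at the measured nodes. Such constant inputs
already determine all edge functions, in two steps.

**All nodes agree, also the unmeasured ones** (`staticOutput_eq_of_measured`). Otherwise take a node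
`j` at which `y` and `y'` differ for some input, with no such node among its descendants. It is not
measured, so it is excited and not a sink. Let `i` be an out-neighbour of `j` that is not a
descendant of another out-neighbour of `j`. Then `j` is the only in-neighbour of `i` that feels
`w_j`, while `d = y'_j - y_j` does not depend on `w_j`. Since `y_i = y'_i`, letting `w_j` run
through `ℝ` shows that `f_{i,j}(x) - f'_{i,j}(x + d)` does not depend on `x`. Scaling the input
down to `0` makes `d` sweep out an interval, so the derivative of `f'_{i,j}` is constant on an
interval, and `f'_{i,j}` is affine by analyticity. This contradicts pure nonlinearity.

**The edge functions agree.** The derivative of the static outputs with respect to the excitations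
is the corresponding set of columns of `(1 - J_G)⁻¹`. For the in-neighbours of a node `i`, the
matrix that routes along the disjoint paths has a submatrix of full row rank
(`exists_pathMatrix`), hence so has `J_G` at the generic point
(`mulVec_subT_surjective`). By the open mapping property of submersions the outputs of the
in-neighbours of `i` fill a neighbourhood of a point, on which `∑ (f_{i,j} - f'_{i,j})(x_j) = 0`.
So each summand is locally constant, hence constant by analyticity, and it vanishes at `0`.
-/

open Filter Topology

/-! ### Real-analytic functions -/

/-- A real-analytic function that is constant near one point is constant. -/
theorem AnalyticOnNhd.eq_const_of_eventuallyEq {g : ℝ → ℝ} (hg : AnalyticOnNhd ℝ g Set.univ)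
    {a c : ℝ} (h : ∀ᶠ x in 𝓝 a, g x = c) (x : ℝ) : g x = c :=
  congrFun (hg.eq_of_eventuallyEq (g := fun _ => c) analyticOnNhd_const h) x

/-- If the shifts of a pure nonlinear function `h` by all `d` between `0` and `D` agree with `g` up to
additive constants, then `D = 0`: otherwise `h'` would be constant between `0` and `D`, and `h`
affine. -/
theorem eq_zero_of_shift_sub_const {g h : ℝ → ℝ} (hg : Differentiable ℝ g) (hh : h ∈ classFZNL)
    {D : ℝ} (hD : ∀ d ∈ Set.uIcc 0 D, ∃ c, ∀ x, g x - h (x + d) = c) : D = 0 := by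
  by_contra hne
  obtain ⟨han, -, ⟨n, hn, hcoef⟩, -⟩ := hh
  have hdiff : Differentiable ℝ h := fun x => (han x trivial).differentiableAt
  have hder : ∀ d ∈ Set.uIcc 0 D, ∀ x, deriv g x = deriv h (x + d) := by
    intro d hd x
    obtain ⟨c, hc⟩ := hD d hd
    have h1 : HasDerivAt (fun x => g x - h (x + d)) (deriv g x - deriv h (x + d)) x :=
      (hg x).hasDerivAt.sub ((hdiff (x + d)).hasDerivAt.comp_add_const x d)
    have h2 : HasDerivAt (fun x => g x - h (x + d)) 0 x := by
      rw [funext hc]; exact hasDerivAt_const x c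
    exact sub_eq_zero.1 (h1.unique h2)
  have hconst : ∀ x, deriv h x = deriv g 0 := by
    refine han.deriv.eq_const_of_eventuallyEq (a := D / 2) ?_
    have hmem : Set.uIoo 0 D ∈ 𝓝 (D / 2) := by
      refine isOpen_Ioo.mem_nhds ?_
      rcases lt_or_gt_of_ne hne with h | h
      · simp only [min_eq_right h.le, max_eq_left h.le]; constructor <;> linarith
      · simp only [min_eq_left h.le, max_eq_right h.le]; constructor <;> linarith
    filter_upwards [hmem] with d hd
    have := hder d (Set.uIoo_subset_uIcc_self hd) 0
    rw [this, zero_add]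
  apply hcoef
  obtain ⟨m, rfl⟩ : ∃ m, n = m + 1 + 1 := ⟨n - 2, by omega⟩
  rw [iteratedDeriv_succ', funext hconst, iteratedDeriv_succ']
  simp

/-- If a sum of analytic functions of separate variables vanishes near a point, and every summand
vanishes at `0`, then all summands vanish. -/
theorem eq_zero_of_eventually_sum_eq_zero {ι : Type*} [Fintype ι] {g : ι → ℝ → ℝ}
    (hg : ∀ j, AnalyticOnNhd ℝ (g j) Set.univ) (hg0 : ∀ j, g j 0 = 0) {a : ι → ℝ}
    (h : ∀ᶠ x in 𝓝 a, ∑ j, g j (x j) = 0) (j : ι) (x : ℝ) : g j x = 0 := by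
  classical
  have hcont : Tendsto (fun t => Function.update a j t) (𝓝 (a j)) (𝓝 a) := by
    have : Continuous fun t => Function.update a j t := by fun_prop
    simpa using this.tendsto (a j)
  have hc : ∀ x, g j x = -∑ l ∈ Finset.univ.erase j, g l (a l) := by
    refine (hg j).eq_const_of_eventuallyEq (a := a j) ?_
    filter_upwards [hcont.eventually h] with t ht
    rw [← Finset.add_sum_erase _ _ (Finset.mem_univ j), Function.update_self] at ht
    rw [eq_neg_iff_add_eq_zero, ← ht]
    congr 1
    refine Finset.sum_congr rfl fun l hl => ?_
    rw [Function.update_of_ne (Finset.ne_of_mem_erase hl)]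
  rw [hc, ← hc 0, hg0]

theorem differentiable_of_mem_classFZNL {f : ℝ → ℝ} (hf : f ∈ classFZNL) : Differentiable ℝ f :=
  fun x => (hf.1 x trivial).differentiableAt

/-! ### Lists and predecessors -/

theorem List.eq_head_or_exists_pred {α : Type*} {s a : α} {p : List α} (hs : p.head? = some s)
    (ha : a ∈ p) : a = s ∨ ∃ b, [b, a] <:+: p := by
  obtain ⟨l, r, rfl⟩ := List.append_of_mem ha
  rcases List.eq_nil_or_concat' l with rfl | ⟨l, b, rfl⟩
  · exact Or.inl (by simpa using hs)
  · exact Or.inr ⟨b, l, r, by simp⟩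

theorem List.Nodup.ne_head_of_infix {α : Type*} {s a b : α} {p : List α} (hp : p.Nodup)
    (hs : p.head? = some s) (h : [b, a] <:+: p) : a ≠ s := by
  rintro rfl
  obtain ⟨l, r, rfl⟩ := h
  cases l <;> simp_all

namespace DAGNetwork

variable {V : Type*}

/-! ### Static outputs -/

section Static

variable [Fintype V] (N : DAGNetwork V)

theorem mem_inNbrs {i j : V} : j ∈ N.inNbrs i ↔ N.graph.Adj j i := by
  simp [inNbrs]

/-- The output of the network at time `0` under inputs `w` that are constant in time; by
`output_const` it is the output at every time. -/
noncomputable def staticOutput (f : V → V → ℝ → ℝ) (w : V → ℝ) (i : V) : ℝ :=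
  N.output f (fun i _ => w i) i 0

theorem output_const (f : V → V → ℝ → ℝ) (w : V → ℝ) (i : V) (k : ℤ) :
    N.output f (fun i _ => w i) i k = N.staticOutput f w i := by
  have h := N.eq_output f (fun i _ => w i) (fun i l => N.output f (fun i _ => w i) i (l + k))
    fun i l => by
      rw [output_eq]
      congr 1
      exact Finset.sum_congr rfl fun j _ => by congr 2; ring
  simpa [staticOutput] using congrFun (congrFun h i) 0

theorem staticOutput_eq (f : V → V → ℝ → ℝ) (w : V → ℝ) (i : V) :
    N.staticOutput f w i = ∑ j ∈ N.inNbrs i, f i j (N.staticOutput f w j) + w i := by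
  conv_lhs => rw [staticOutput, output_eq]
  simp only [output_const]

/-- The static output of a node depends only on the inputs of the node and of its ancestors. -/
theorem staticOutput_congr (f : V → V → ℝ → ℝ) {w w' : V → ℝ} {i : V}
    (h : ∀ b, Relation.ReflTransGen N.graph.Adj b i → w b = w' b) :
    N.staticOutput f w i = N.staticOutput f w' i := by
  induction i using N.wellFounded_adj.induction with
  | _ i ih =>
    rw [staticOutput_eq, staticOutput_eq, h i .refl]
    congr 1
    refine Finset.sum_congr rfl fun j hj => ?_
    rw [mem_inNbrs] at hj
    rw [ih j hj fun b hb => h b (hb.tail hj)]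

theorem staticOutput_update_of_not_reach [DecidableEq V] (f : V → V → ℝ → ℝ) (w : V → ℝ) {i j : V}
    (s : ℝ) (h : ¬ Relation.ReflTransGen N.graph.Adj j i) :
    N.staticOutput f (Function.update w j s) i = N.staticOutput f w i :=
  N.staticOutput_congr f fun b hb => Function.update_of_ne (by rintro rfl; exact h hb) _ _

theorem staticOutput_update_self [DecidableEq V] (f : V → V → ℝ → ℝ) (w : V → ℝ) (j : V) (s : ℝ) :
    N.staticOutput f (Function.update w j s) j = N.staticOutput f w j + (s - w j) := by
  rw [staticOutput_eq, N.staticOutput_eq f w, Function.update_self]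
  rw [Finset.sum_congr rfl fun l hl => by
    rw [N.staticOutput_update_of_not_reach f w s fun h =>
      N.acyclic j (.tail' h ((N.mem_inNbrs).1 hl))]]
  ring

theorem staticOutput_zero {f : V → V → ℝ → ℝ} (hf : N.EdgesIn classFZNL f) (i : V) :
    N.staticOutput f 0 i = 0 := by
  induction i using N.wellFounded_adj.induction with
  | _ i ih =>
    rw [staticOutput_eq, Finset.sum_eq_zero fun j hj => ?_]
    · simp
    · rw [mem_inNbrs] at hj
      rw [ih j hj, (hf i j hj).2.1]

theorem contDiff_staticOutput {f : V → V → ℝ → ℝ} (hf : N.EdgesIn classFZNL f) (i : V) :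
    ContDiff ℝ 1 fun w => N.staticOutput f w i := by
  induction i using N.wellFounded_adj.induction with
  | _ i ih =>
    simp only [N.staticOutput_eq f _ i]
    refine ContDiff.add (ContDiff.sum fun j hj => ?_) (contDiff_apply ℝ ℝ i)
    rw [mem_inNbrs] at hj
    have : ContDiff ℝ 1 (f i j) :=
      contDiff_iff_contDiffAt.2 fun x => ((hf i j hj).1 x trivial).contDiffAt
    exact this.comp (ih j hj)

end Static

/-! ### Agreement of the unmeasured outputs -/

/-- Among the out-neighbours of a node there is one, `i`, that is not a descendant of another: no
in-neighbour of `i` other than `j` is reachable from `j`. -/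
theorem exists_first_outNbr [Fintype V] (N : DAGNetwork V) {j : V} (hj : ¬ N.IsSink j) :
    ∃ i, N.graph.Adj j i ∧
      ∀ l, N.graph.Adj l i → l ≠ j → ¬ Relation.ReflTransGen N.graph.Adj j l := by
  have hne : {i | N.graph.Adj j i}.Nonempty := by simpa [IsSink, Set.Nonempty] using hj
  have hwf := N.wellFounded_adj.transGen
  refine ⟨hwf.min _ hne, hwf.min_mem _ hne, fun l hl hlj hreach => ?_⟩
  obtain rfl | ⟨m, hjm, hml⟩ := hreach.cases_head
  · exact hlj rfl
  · exact hwf.not_lt_min _ (show m ∈ {i | N.graph.Adj j i} from hjm) (.tail' hml hl)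

/-- If two networks have the same static outputs at the measured nodes, every other node being
excited and no sink, then they have the same static outputs at all nodes. -/
theorem staticOutput_eq_of_measured [Fintype V] [DecidableEq V] (N : DAGNetwork V)
    {Ne Nm : Finset V} {f f' : V → V → ℝ → ℝ} (hf : N.EdgesIn classFZNL f)
    (hf' : N.EdgesIn classFZNL f') (hun : ∀ i ∉ Nm, i ∈ Ne ∧ ¬ N.IsSink i)
    (hmeas : ∀ w : V → ℝ, (∀ b ∉ Ne, w b = 0) → ∀ i ∈ Nm,
      N.staticOutput f w i = N.staticOutput f' w i)
    {w : V → ℝ} (hw : ∀ b ∉ Ne, w b = 0) (j : V) :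
    N.staticOutput f w j = N.staticOutput f' w j := by
  -- Induction from the sinks upwards: the descendants of `j` are already known to agree.
  have : Std.Irrefl (Relation.TransGen (Function.swap N.graph.Adj)) :=
    ⟨fun i h => N.acyclic i (Relation.transGen_swap.1 h)⟩
  have hwf : WellFounded (Relation.TransGen (Function.swap N.graph.Adj)) :=
    Finite.wellFounded_of_trans_of_irrefl _
  induction j using hwf.induction generalizing w with
  | _ j ih =>
    by_cases hjm : j ∈ Nm
    · exact hmeas w hw j hjm
    obtain ⟨hje, hsink⟩ := hun j hjm
    obtain ⟨i, hji, hi⟩ := N.exists_first_outNbr hsink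
    suffices h : N.staticOutput f' w j - N.staticOutput f w j = 0 by linarith
    refine eq_zero_of_shift_sub_const
      (differentiable_of_mem_classFZNL (hf i j hji)) (hf' i j hji) fun d hd => ?_
    -- Scaling the input realizes every discrepancy `d` between `0` and the given one.
    obtain ⟨t, rfl⟩ : ∃ t : ℝ, N.staticOutput f' (t • w) j - N.staticOutput f (t • w) j = d := by
      have hc : Continuous fun t : ℝ =>
          N.staticOutput f' (t • w) j - N.staticOutput f (t • w) j := by
        have h1 := (N.contDiff_staticOutput hf j).continuous
        have h2 := (N.contDiff_staticOutput hf' j).continuous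
        exact (h2.comp (by fun_prop)).sub (h1.comp (by fun_prop))
      have hivt := intermediate_value_uIcc (a := (0 : ℝ)) (b := 1) hc.continuousOn
      simp only [zero_smul, one_smul, staticOutput_zero N hf, staticOutput_zero N hf',
        sub_self] at hivt
      obtain ⟨t, -, ht⟩ := hivt hd
      exact ⟨t, ht⟩
    set z := t • w with hz
    have hz0 : ∀ b ∉ Ne, z b = 0 := fun b hb => by simp [hz, hw b hb]
    refine ⟨∑ l ∈ (N.inNbrs i).erase j, f' i l (N.staticOutput f' z l) -
      ∑ l ∈ (N.inNbrs i).erase j, f i l (N.staticOutput f z l), fun x => ?_⟩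
    -- Move the input at `j` so that the output of `j` becomes `x`.
    have hj := ih i (.single hji) (w := Function.update z j (z j + (x - N.staticOutput f z j)))
      fun b hb => by
        rw [Function.update_of_ne (by rintro rfl; exact hb hje), hz0 b hb]
    have hjmem : j ∈ N.inNbrs i := N.mem_inNbrs.2 hji
    have herase : ∀ g : V → V → ℝ → ℝ, ∀ s, ∑ l ∈ (N.inNbrs i).erase j,
        g i l (N.staticOutput g (Function.update z j s) l) =
          ∑ l ∈ (N.inNbrs i).erase j, g i l (N.staticOutput g z l) := by
      refine fun g s => Finset.sum_congr rfl fun l hl => ?_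
      rw [Finset.mem_erase, mem_inNbrs] at hl
      rw [N.staticOutput_update_of_not_reach g z s (hi l hl.2 hl.1)]
    rw [staticOutput_eq, N.staticOutput_eq f', ← Finset.add_sum_erase _ _ hjmem,
      ← Finset.add_sum_erase _ _ hjmem, herase, herase, staticOutput_update_self,
      staticOutput_update_self] at hj
    ring_nf at hj ⊢
    linarith

/-! ### Constant excitations -/

section Extend

variable [DecidableEq V]

/-- The extension of the inputs by zero, as a linear map on constant inputs. -/
noncomputable def extendCLM (Ne : Finset V) : (Ne → ℝ) →L[ℝ] (V → ℝ) :=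
  ContinuousLinearMap.pi fun i =>
    if h : i ∈ Ne then ContinuousLinearMap.proj (⟨i, h⟩ : Ne) else 0

theorem extendInput_const (Ne : Finset V) (v : Ne → ℝ) :
    extendInput Ne (fun e _ => v e) = fun i _ => extendCLM Ne v i := by
  funext i k
  by_cases h : i ∈ Ne <;> simp [extendInput, extendCLM, h]

theorem extendCLM_restrict {Ne : Finset V} {w : V → ℝ} (hw : ∀ b ∉ Ne, w b = 0) :
    extendCLM Ne (fun e => w e) = w := by
  funext i
  by_cases h : i ∈ Ne <;> simp [extendCLM, h, hw]

theorem extendCLM_of_notMem {Ne : Finset V} (v : Ne → ℝ) {i : V} (h : i ∉ Ne) :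
    extendCLM Ne v i = 0 := by
  simp [extendCLM, h]

end Extend

/-! ### Rank of the network matrix -/

section Rank

variable [Fintype V] [DecidableEq V] (N : DAGNetwork V)

theorem isUnit_one_sub {M : Matrix V V ℝ} (hM : ∀ i j, ¬ N.graph.Adj j i → M i j = 0) :
    IsUnit (1 - M) := by
  rw [← Matrix.mulVec_injective_iff_isUnit, ← Matrix.coe_mulVecLin, injective_iff_map_eq_zero]
  intro x hx
  rw [Matrix.mulVecLin_apply, Matrix.sub_mulVec, Matrix.one_mulVec, sub_eq_zero] at hx
  funext i
  induction i using N.wellFounded_adj.induction with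
  | _ i ih =>
    rw [hx]
    refine Finset.sum_eq_zero fun j _ => ?_
    by_cases h : N.graph.Adj j i
    · rw [ih j h]; simp
    · simp [hM i j h]

/-- A solution of `x = M x + c` is given by the corresponding columns of `(1 - M)⁻¹`. -/
theorem eq_inv_mulVec {M : Matrix V V ℝ} (hM : ∀ i j, ¬ N.graph.Adj j i → M i j = 0)
    {x c : V → ℝ} (h : x = M.mulVec x + c) : x = ((1 - M)⁻¹).mulVec c := by
  have hc : (1 - M).mulVec x = c := by
    rw [Matrix.sub_mulVec, Matrix.one_mulVec, sub_eq_iff_eq_add']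
    exact h
  rw [← hc, Matrix.mulVec_mulVec,
    Matrix.nonsing_inv_mul _ ((Matrix.isUnit_iff_isUnit_det _).1 (N.isUnit_one_sub hM)),
    Matrix.one_mulVec]

/-- Disjoint paths from `A` to `B` are realized by a matrix on the edges: it routes along the paths
and nowhere else, so that `(1 - M)⁻¹` carries the start of each path to its end point only. -/
theorem exists_pathMatrix {A B : Finset V} (h : N.HasDisjointPaths A B) :
    ∃ M : Matrix V V ℝ, (∀ i j, ¬ N.graph.Adj j i → M i j = 0) ∧
      ∃ s : V → V, ∀ j ∈ B, s j ∈ A ∧ ∀ l ∈ B, (1 - M)⁻¹ l (s j) = if l = j then 1 else 0 := by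
  classical
  obtain ⟨s, p, hp, hdisj⟩ := h
  have huniq : ∀ j ∈ B, ∀ l ∈ B, ∀ a, a ∈ p j → a ∈ p l → j = l := fun j hj l hl a h1 h2 =>
    by_contra fun hne => hdisj j hj l hl hne h1 h2
  -- `P b a`: the node `b` precedes `a` on one of the paths.
  let P : V → V → Prop := fun b a => ∃ j ∈ B, [b, a] <:+: p j
  let M : Matrix V V ℝ := fun a b => if h : ∃ b, P b a then (if b = h.choose then 1 else 0) else 0
  have hM : ∀ i j, ¬ N.graph.Adj j i → M i j = 0 := by
    intro i j hij
    by_cases h : ∃ b, P b i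
    · simp only [M, dif_pos h]
      refine if_neg ?_
      rintro rfl
      obtain ⟨l, hl, hinf⟩ := h.choose_spec
      have := (hp l hl).2.1.infix hinf
      exact hij (by simpa using this)
    · simp only [M, dif_neg h]
  have hlast : ∀ j ∈ B, j ∈ p j := fun j hj => List.mem_of_getLast? (hp j hj).2.2.2.2
  refine ⟨M, hM, s, fun j hj => ⟨(hp j hj).1, fun l hl => ?_⟩⟩
  -- The column of `(1 - M)⁻¹` at the start of a path is the indicator of that path.
  have hcol : (fun a => if a ∈ p j then (1 : ℝ) else 0) =
      M.mulVec (fun a => if a ∈ p j then (1 : ℝ) else 0) + Pi.single (s j) 1 := by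
    funext a
    by_cases h : ∃ b, P b a
    · have hMa : ∀ b, M a b = if b = h.choose then 1 else 0 := fun b => by simp only [M, dif_pos h]
      obtain ⟨l, hl, hinf⟩ := h.choose_spec
      have hal : a ∈ p l := hinf.subset (by simp)
      have hbl : h.choose ∈ p l := hinf.subset (by simp)
      have has : a ≠ s j := by
        rintro rfl
        have hjl := huniq j hj l hl _ (List.mem_of_head? (hp j hj).2.2.2.1) hal
        subst hjl
        exact (hp j hj).2.2.1.ne_head_of_infix (hp j hj).2.2.2.1 hinf rfl
      have hiff : a ∈ p j ↔ h.choose ∈ p j :=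
        ⟨fun h' => by rwa [huniq j hj l hl _ h' hal], fun h' => by rwa [huniq j hj l hl _ h' hbl]⟩
      rw [Pi.add_apply, Pi.single_eq_of_ne has, add_zero, Matrix.mulVec, dotProduct,
        Finset.sum_eq_single h.choose (fun b _ hb => by rw [hMa, if_neg hb, zero_mul]) (by simp),
        hMa, if_pos rfl, one_mul]
      simp only [hiff]
    · have hMa : ∀ b, M a b = 0 := fun b => by simp only [M, dif_neg h]
      have hiff : a ∈ p j ↔ a = s j := by
        refine ⟨fun ha => ?_, fun ha => ha ▸ List.mem_of_head? (hp j hj).2.2.2.1⟩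
        refine (List.eq_head_or_exists_pred (hp j hj).2.2.2.1 ha).resolve_right ?_
        rintro ⟨b, hb⟩
        exact h ⟨b, j, hj, hb⟩
      simp [Matrix.mulVec, dotProduct, hMa, hiff, Pi.single_apply]
  have hcl := congrFun (N.eq_inv_mulVec hM hcol) l
  rw [Matrix.mulVec_single_one] at hcl
  have hiff : l ∈ p j ↔ l = j :=
    ⟨fun h' => huniq l hl j hj l (hlast l hl) h', fun h' => h' ▸ hlast l hl⟩
  simpa [hiff] using hcl.symm

/-- At a point of generic rank, the rows of `(1 - J)⁻¹` at the end points of disjoint paths from `A`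
are independent on the columns `A`. -/
theorem mulVec_subT_surjective {A B : Finset V} (h : N.HasDisjointPaths A B) {J : Matrix V V ℝ}
    (hJ : ∀ M : Matrix V V ℝ, (∀ i j, ¬ N.graph.Adj j i → M i j = 0) →
      (subT M B A).rank ≤ (subT J B A).rank) :
    Function.Surjective (subT J B A).mulVec := by
  obtain ⟨M, hM, s, hs⟩ := N.exists_pathMatrix h
  have hMsurj : Function.Surjective (subT M B A).mulVecLin := by
    intro x
    refine ⟨∑ j : B, x j • Pi.single ⟨s j, (hs j j.2).1⟩ 1, ?_⟩
    rw [map_sum]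
    funext l
    simp only [map_smul, Matrix.mulVecLin_apply, Matrix.mulVec_single_one, Finset.sum_apply,
      Pi.smul_apply, Matrix.col_apply, subT, Matrix.submatrix_apply, smul_eq_mul]
    simp [fun j : B => (hs j j.2).2 l l.2]
  have hrank := hJ M hM
  rw [Matrix.rank, LinearMap.range_eq_top.2 hMsurj, finrank_top] at hrank
  rw [← Matrix.coe_mulVecLin, ← LinearMap.range_eq_top]
  exact Submodule.eq_top_of_finrank_eq (le_antisymm (Submodule.finrank_le _) hrank)

theorem netMatrix_eq_zero (Ne : Finset V) (f : V → V → ℝ → ℝ) (v : Ne → ℝ) (i j : V)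
    (h : ¬ N.graph.Adj j i) : N.netMatrix Ne f v i j = 0 := by
  simp [netMatrix, h]

theorem netMatrix_apply (Ne : Finset V) (f : V → V → ℝ → ℝ) (v : Ne → ℝ) (i j : V)
    (h : N.graph.Adj j i) :
    N.netMatrix Ne f v i j = deriv (f i j) (N.staticOutput f (extendCLM Ne v) j) := by
  simp [netMatrix, h, extendInput_const, output_const]

/-- The derivative of the static outputs with respect to the excitations is given by the columns
of `(1 - J_G(v))⁻¹` at the excited nodes. -/
theorem fderiv_staticOutput {Ne : Finset V} {f : V → V → ℝ → ℝ} (hf : N.EdgesIn classFZNL f)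
    (v x : Ne → ℝ) (B : Finset V) (l : B) :
    fderiv ℝ (fun v => N.staticOutput f (extendCLM Ne v) l) v x =
      (subT (N.netMatrix Ne f v) B Ne).mulVec x l := by
  have hd : ∀ i, DifferentiableAt ℝ (fun v => N.staticOutput f (extendCLM Ne v) i) v := fun i =>
    ((N.contDiff_staticOutput hf i).comp (extendCLM Ne).contDiff).differentiable
      one_ne_zero v
  -- Differentiating the static equation gives `y' = J y' + x`.
  have hlin : (fun i => fderiv ℝ (fun v => N.staticOutput f (extendCLM Ne v) i) v x) =
      (N.netMatrix Ne f v).mulVec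
        (fun i => fderiv ℝ (fun v => N.staticOutput f (extendCLM Ne v) i) v x) +
      extendCLM Ne x := by
    funext i
    have hsum : HasFDerivAt (fun v => N.staticOutput f (extendCLM Ne v) i)
        (∑ j ∈ N.inNbrs i, deriv (f i j) (N.staticOutput f (extendCLM Ne v) j) •
          fderiv ℝ (fun v => N.staticOutput f (extendCLM Ne v) j) v +
          (ContinuousLinearMap.proj i).comp (extendCLM Ne)) v := by
      simp only [N.staticOutput_eq f _ i]
      refine HasFDerivAt.add (HasFDerivAt.fun_sum fun j hj => ?_) ?_
      · have := (differentiable_of_mem_classFZNL (hf i j (N.mem_inNbrs.1 hj))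
          (N.staticOutput f (extendCLM Ne v) j)).hasDerivAt
        exact this.comp_hasFDerivAt v (hd j).hasFDerivAt
      · exact ((ContinuousLinearMap.proj i).comp (extendCLM Ne)).hasFDerivAt
    rw [hsum.fderiv]
    simp only [add_apply, sum_apply, Pi.add_apply,
      Matrix.mulVec, dotProduct]
    congr 1
    rw [← Finset.sum_subset (Finset.subset_univ (N.inNbrs i)) fun j _ hj => by
      rw [N.netMatrix_eq_zero Ne f v i j (mt N.mem_inNbrs.2 hj), zero_mul]]
    refine Finset.sum_congr rfl fun j hj => ?_
    rw [N.netMatrix_apply Ne f v i j (N.mem_inNbrs.1 hj)]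
    rfl
  rw [congrFun (N.eq_inv_mulVec (N.netMatrix_eq_zero Ne f v) hlin) l]
  simp only [Matrix.mulVec, dotProduct, subT, Matrix.submatrix_apply]
  rw [← Finset.sum_subset (Finset.subset_univ Ne) fun j _ hj => by
    rw [extendCLM_of_notMem x hj, mul_zero], ← Finset.sum_coe_sort]
  refine Finset.sum_congr rfl fun j _ => ?_
  simp [extendCLM]

/-- Networks that have the same static outputs at all nodes have the same edge functions into `i`,
if the outputs of the in-neighbours of `i` are independent to first order at some point. -/
theorem edge_eq_of_staticOutput_eq {Ne : Finset V} {f f' : V → V → ℝ → ℝ}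
    (hf : N.EdgesIn classFZNL f) (hf' : N.EdgesIn classFZNL f') (i : V)
    (heq : ∀ (v : Ne → ℝ) (j : V),
      N.staticOutput f (extendCLM Ne v) j = N.staticOutput f' (extendCLM Ne v) j)
    (v : Ne → ℝ) (hsurj : Function.Surjective (subT (N.netMatrix Ne f v) (N.inNbrs i) Ne).mulVec)
    (j : V) (hij : N.graph.Adj j i) : f i j = f' i j := by
  let Y : (Ne → ℝ) → N.inNbrs i → ℝ := fun v l => N.staticOutput f (extendCLM Ne v) l
  have hYl : ∀ l : N.inNbrs i, ContDiff ℝ 1 fun v => Y v l := fun l =>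
    (N.contDiff_staticOutput hf l).comp (extendCLM Ne).contDiff
  have hY : HasStrictFDerivAt Y
      (ContinuousLinearMap.pi fun l => fderiv ℝ (fun v => Y v l) v) v :=
    hasStrictFDerivAt_pi.2 fun l => (hYl l).contDiffAt.hasStrictFDerivAt one_ne_zero
  have hopen : map Y (𝓝 v) = 𝓝 (Y v) := by
    refine hY.map_nhds_eq_of_surj (LinearMap.range_eq_top.2 fun x => ?_)
    obtain ⟨u, hu⟩ := hsurj x
    refine ⟨u, funext fun l => ?_⟩
    rw [← hu]
    exact N.fderiv_staticOutput hf v u (N.inNbrs i) l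
  have hadj : ∀ l : N.inNbrs i, N.graph.Adj l i := fun l => N.mem_inNbrs.1 l.2
  have hsum : ∀ᶠ x in 𝓝 (Y v), ∑ l : N.inNbrs i, (f i l - f' i l) (x l) = 0 := by
    rw [← hopen, eventually_map]
    refine Eventually.of_forall fun u => ?_
    have h := heq u i
    rw [staticOutput_eq, N.staticOutput_eq f', add_left_inj] at h
    simp only [← heq] at h
    simp only [Y, Pi.sub_apply, Finset.sum_sub_distrib]
    rw [sub_eq_zero, Finset.sum_coe_sort (N.inNbrs i)
      fun l => f i l (N.staticOutput f (extendCLM Ne u) l), h, ← Finset.sum_coe_sort]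
  funext x
  exact sub_eq_zero.1 <| eq_zero_of_eventually_sum_eq_zero (g := fun l : N.inNbrs i => f i l - f' i l)
    (fun l => (hf i l (hadj l)).1.sub (hf' i l (hadj l)).1)
    (fun l => by simp [(hf i l (hadj l)).2.1, (hf' i l (hadj l)).2.1]) hsum
    ⟨j, N.mem_inNbrs.2 hij⟩ x

end Rank

theorem numActions_eq_card_iff [Fintype V] [DecidableEq V] {Ne Nm : Finset V}
    (h : ∀ i, i ∈ Ne ∨ i ∈ Nm) : numActions Ne Nm = Fintype.card V ↔ Disjoint Ne Nm := by
  have hu : Ne ∪ Nm = Finset.univ := by ext i; simpa using h i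
  rw [← Finset.card_union_eq_card_add_card, hu, Finset.card_univ, numActions, eq_comm]

end DAGNetwork

/-! ### Identifiability -/

theorem theorem1 {V : Type*} [Fintype V] [DecidableEq V] (N : DAGNetwork V) (Ne Nm : Finset V)
    (f : V → V → ℝ → ℝ) (hf : N.EdgesIn classFZNL f)
    (hgen : N.IsGeneric Ne f)
    (hsource : ∀ i, N.IsSource i → i ∈ Ne)
    (hsink : ∀ i, N.IsSink i → i ∈ Nm)
    (hother : ∀ i, ¬ N.IsSource i → ¬ N.IsSink i → i ∈ Ne ∨ i ∈ Nm)
    (hpaths : ∀ i, N.HasDisjointPaths Ne (N.inNbrs i)) :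
    N.IsIdentifiable classFZNL Ne Nm f ∧
      (DAGNetwork.numActions Ne Nm = Fintype.card V ↔ Disjoint Ne Nm) := by
  have hcover : ∀ i, i ∈ Ne ∨ i ∈ Nm := fun i => by
    by_cases h1 : N.IsSource i
    · exact .inl (hsource i h1)
    by_cases h2 : N.IsSink i
    · exact .inr (hsink i h2)
    exact hother i h1 h2
  refine ⟨fun f' hf' hF i j hij => ?_, DAGNetwork.numActions_eq_card_iff hcover⟩
  have hmeas : ∀ w : V → ℝ, (∀ b ∉ Ne, w b = 0) → ∀ i ∈ Nm,
      N.staticOutput f w i = N.staticOutput f' w i := by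
    intro w hw i hi
    have h := congrFun (congrFun (hF i hi) fun e _ => w e) 0
    simpa only [DAGNetwork.nodeFun, DAGNetwork.extendInput_const,
      DAGNetwork.extendCLM_restrict hw, DAGNetwork.output_const, sub_left_inj] using h
  have hun : ∀ i ∉ Nm, i ∈ Ne ∧ ¬ N.IsSink i := fun i hi =>
    ⟨(hcover i).resolve_right hi, fun h => hi (hsink i h)⟩
  obtain ⟨v, hv⟩ := hgen
  exact N.edge_eq_of_staticOutput_eq hf hf' i
    (fun u l => N.staticOutput_eq_of_measured hf hf' hun hmeas
      (fun b hb => DAGNetwork.extendCLM_of_notMem u hb) l)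
    v (N.mulVec_subT_surjective (hpaths i) (hv _ _)) j hij
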